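/- On the region $r>0$, $y(r)>0$, $0<\theta<\pi$ with coordinates $(x^0,x^1,x^2,x^3)=(t,r,\theta,\phi)$, consider the static metric $$ds^2=-y(r)\,dt^2+\frac{h(r)^2}{y(r)}\,dr^2+r^2(d\theta^2+\sin^2\theta\,d\phi^2)$$ with $h=1$ and $y(r)=1-\frac{2M}{r}-\frac{\Lambda}{3}r^2-\frac{\lambda}{5}r^4$, where $M,\Lambda,\lambda\in\mathbb R$ (Harada's vacuum metric). Let $R_{jklm}$ be its Riemann tensor, $R_{km}=g^{jl}R_{jklm}$ its Ricci tensor, with the sign that gives round spheres positive Ricci curvature, $R$ its scalar curvature, $G_{kl}=R_{kl}-\frac12Rg_{kl}$, $\nabla^2=g^{ab}\nabla_a\nabla_b$, and let $$\Phi_{kl}=g_{kl}\Big(\tfrac12G_{pq}G^{pq}-\tfrac16R^2+\tfrac12\nabla^2R\Big)+4R_{jklm}G^{mj}+2G_{km}G_l{}^m+\tfrac43R\,G_{kl}$$ be the (corrected) Altas–Tekin tensor. Let $\xi=\partial_t$ be the static Killing vector, $\xi^j=\delta^j{}_0$. Then the following hold. 1. At every point, the Altas–Tekin current is proportional to the Killing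 vector, $\Phi_{kl}\xi^l=\varphi\,\xi_k$, with the unique proportionality factor $$\varphi(r)=-\frac{32M\lambda}{r}+18\lambda-\frac{20}{3}\Lambda\lambda r^2-\frac{21}{5}\lambda^2r^4 .$$ 2. For every nonempty open subset $U$ of the region, the current $\Phi_{kl}\xi^l$ vanishes identically on $U$ if and only if $\lambda=0$. 3. If $\lambda=0$, the metric is the Schwarzschild–de Sitter metric, with $y(r)=1-\frac{2M}{r}-\frac{\Lambda}{3}r^2$, and $G_{kl}=-\Lambda g_{kl}$. -/

import Mathlib

open scoped Matrix

noncomputable section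

namespace HaradaVacuum

/-- Points of a coordinate chart; the coordinates are numbered
`0 = t`, `1 = r`, `2 = θ`, `3 = φ`. -/
abbrev Point := Fin 4 → ℝ

/-- A field of covariant 2-tensors in the chart (for example a metric). -/
abbrev Tensor2 := Point → Matrix (Fin 4) (Fin 4) ℝ

/-- The partial derivative `∂_i f` at `x`. -/
def partialD (i : Fin 4) (f : Point → ℝ) (x : Point) : ℝ :=
  deriv (fun s : ℝ => f (Function.update x i s)) (x i)

/-- The inverse metric `g^{ij}`. -/
def invMetric (g : Tensor2) : Tensor2 := fun x => (g x)⁻¹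

/-- Christoffel symbols `Γ^a_{bc} = ½ g^{ae} (∂_b g_{ec} + ∂_c g_{eb} - ∂_e g_{bc})`. -/
def christoffel (g : Tensor2) (a b c : Fin 4) (x : Point) : ℝ :=
  (1 / 2) * ∑ e, invMetric g x a e *
    (partialD b (fun z => g z e c) x + partialD c (fun z => g z e b) x
      - partialD e (fun z => g z b c) x)

/-- The Riemann tensor `R^a_{bcd} = ∂_c Γ^a_{db} - ∂_d Γ^a_{cb}
+ Γ^a_{ce} Γ^e_{db} - Γ^a_{de} Γ^e_{cb}`. -/
def riemannUp (g : Tensor2) (a b c d : Fin 4) (x : Point) : ℝ :=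
  partialD c (christoffel g a d b) x - partialD d (christoffel g a c b) x
    + ∑ e, (christoffel g a c e x * christoffel g e d b x
        - christoffel g a d e x * christoffel g e c b x)

/-- The fully covariant Riemann tensor `R_{abcd} = g_{ae} R^e_{bcd}`. -/
def riemann (g : Tensor2) (a b c d : Fin 4) (x : Point) : ℝ :=
  ∑ e, g x a e * riemannUp g e b c d x

/-- The Ricci tensor `R_{bd} = R^a_{bad}`. -/
def ricci (g : Tensor2) : Tensor2 := fun x =>
  Matrix.of fun b d => ∑ a, riemannUp g a b a d x

/-- The curvature scalar `R = g^{ab} R_{ab}`. -/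
def scalarCurv (g : Tensor2) (x : Point) : ℝ :=
  ∑ a, ∑ b, invMetric g x a b * ricci g x a b

/-- The Einstein tensor `G_{kl} = R_{kl} - ½ R g_{kl}`. -/
def einstein (g : Tensor2) : Tensor2 := fun x =>
  ricci g x - ((1 / 2) * scalarCurv g x) • g x

/-- The Einstein tensor with both indices raised,
`G^{kl} = g^{ka} g^{lb} G_{ab}`. -/
def einsteinUp (g : Tensor2) : Tensor2 := fun x =>
  Matrix.of fun k l => ∑ a, ∑ b, invMetric g x k a * invMetric g x l b * einstein g x a b

/-- The Laplace–Beltrami (wave) operator on scalars,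
`∇² f = g^{ab} (∂_a ∂_b f - Γ^c_{ab} ∂_c f)`. -/
def laplacian (g : Tensor2) (f : Point → ℝ) (x : Point) : ℝ :=
  ∑ a, ∑ b, invMetric g x a b *
    (partialD a (partialD b f) x - ∑ c, christoffel g c a b x * partialD c f x)

/-- The (corrected) Altas–Tekin tensor
`Φ_{kl} = g_{kl} (½ G_{pq} G^{pq} - ⅙ R² + ½ ∇² R)
  + 4 R_{jklm} G^{mj} + 2 G_{km} G_l^m + (4/3) R G_{kl}`. -/
def altasTekin (g : Tensor2) : Tensor2 := fun x =>
  Matrix.of fun k l =>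
    g x k l * ((1 / 2) * (∑ p, ∑ q, einstein g x p q * einsteinUp g x p q)
        - (1 / 6) * scalarCurv g x ^ 2 + (1 / 2) * laplacian g (scalarCurv g) x)
      + 4 * (∑ j, ∑ m, riemann g j k l m x * einsteinUp g x m j)
      + 2 * (∑ m, ∑ n, einstein g x k m * invMetric g x m n * einstein g x l n)
      + (4 / 3) * scalarCurv g x * einstein g x k l

/-- The static Killing vector `ξ^j = δ^j_0`. -/
def killing : Fin 4 → ℝ := Pi.single 0 1

/-- Covariant components `ξ_k = g_{kl} ξ^l` of the static Killing vector. -/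
def killingLow (g : Tensor2) (x : Point) : Fin 4 → ℝ := g x *ᵥ killing

/-- The Altas–Tekin current `Φ_{kl} ξ^l`. -/
def current (g : Tensor2) (x : Point) : Fin 4 → ℝ := altasTekin g x *ᵥ killing

/-- `c` is the value at `x` of the current scalar: `Φ_{kl} ξ^l = c ξ_k`. -/
def IsCurrentScalar (g : Tensor2) (x : Point) (c : ℝ) : Prop :=
  ∀ k, current g x k = c * killingLow g x k

/-- The static spherically symmetric metric
`-y dt² + (h²/y) dr² + r² (dθ² + sin² θ dφ²)`. -/
def staticMetric (y h : ℝ → ℝ) : Tensor2 := fun x =>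
  Matrix.diagonal ![-y (x 1), h (x 1) ^ 2 / y (x 1), x 1 ^ 2,
    x 1 ^ 2 * Real.sin (x 2) ^ 2]

/-- The coordinate domain of the static spherically symmetric metric:
`r > 0`, `y(r) > 0`, `0 < θ < π`. -/
def staticChart (y : ℝ → ℝ) : Set Point :=
  {x | 0 < x 1 ∧ 0 < y (x 1) ∧ 0 < x 2 ∧ x 2 < Real.pi}

/-- Harada's `y(r) = 1 - 2M/r - Λ r²/3 - lam r⁴/5`. -/
def haradaY (M Λ lam : ℝ) (r : ℝ) : ℝ :=
  1 - 2 * M / r - Λ / 3 * r ^ 2 - lam / 5 * r ^ 4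

/-- The Harada vacuum metric: `h = 1` and `y` as above. -/
def haradaMetric (M Λ lam : ℝ) : Tensor2 :=
  staticMetric (haradaY M Λ lam) (fun _ => 1)

end HaradaVacuum

end

open scoped Matrix

noncomputable section

namespace HaradaVacuum

open Filter Topology

/-! For h = 1 and any twice differentiable y, the Riemann tensor is determined by one sectional
curvature per coordinate plane (`riemannUp_lapseMetric`), so all contractions are diagonal. Ricci
has an eigenvalue a on the t-r plane and b on the spheres. Hence R = 2(a + b), and G has eigenvalue
-b on the t-r plane and -a on the spheres. The current therefore has only a time component, a
multiple of ξ_0 = -y ≠ 0, which gives both existence and uniqueness of the factor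
(`current_lapseMetric`).

For Harada's y the mass cancels from the Ricci tensor: a = Λ + 2λr² and b = Λ + λr². It reenters
through the sectional curvatures and the wave operator applied to R = 4Λ + 6λr², producing φ. If λ =
0 then a = b = Λ, so G = -Λg. Conversely, 15rφ is a polynomial in r whose linear coefficient is
270λ; an open set supplies infinitely many zeros, forcing λ = 0. -/

/-! ### Coordinate derivatives and the chart -/

theorem partialD_congr {f F : Point → ℝ} {x : Point} (i : Fin 4) (h : f =ᶠ[𝓝 x] F) :
    partialD i f x = partialD i F x := by
  unfold partialD
  apply Filter.EventuallyEq.deriv_eq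
  have hc : Tendsto (fun s : ℝ => Function.update x i s) (𝓝 (x i)) (𝓝 x) := by
    have h1 : Continuous (fun s : ℝ => Function.update x i s) := by fun_prop
    simpa using h1.tendsto (x i)
  exact hc.eventually h

/-- The partial derivatives of a product of a radial and a polar factor. -/
theorem partialD_mul_radial_polar {A B : ℝ → ℝ} {A' B' : ℝ} {x : Point}
    (hA : HasDerivAt A A' (x 1)) (hB : HasDerivAt B B' (x 2)) (i : Fin 4) :
    partialD i (fun z => A (z 1) * B (z 2)) x = ![0, A' * B (x 2), A (x 1) * B', 0] i := by
  fin_cases i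
  · simp [partialD, Function.update]
  · simpa [partialD, Function.update] using (hA.mul_const (B (x 2))).deriv
  · simpa [partialD, Function.update] using (hB.const_mul (A (x 1))).deriv
  · simp [partialD, Function.update]

theorem partialD_radial {A : ℝ → ℝ} {A' : ℝ} {x : Point}
    (hA : HasDerivAt A A' (x 1)) (i : Fin 4) :
    partialD i (fun z => A (z 1)) x = ![0, A', 0, 0] i := by
  have := partialD_mul_radial_polar hA (hasDerivAt_const (x 2) (1 : ℝ)) i
  simpa using this

/-- Closed formulas hold only on the chart. Openness, with `partialD_congr`, allows them to be
differentiated again. -/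
theorem isOpen_staticChart {y : ℝ → ℝ} (hy : ∀ r, 0 < r → ContinuousAt y r) :
    IsOpen (staticChart y) := by
  rw [isOpen_iff_mem_nhds]
  rintro x ⟨h1, h2, h3, h4⟩
  have c1 : ContinuousAt (fun z : Point => z 1) x := (continuous_apply 1).continuousAt
  have c2 : ContinuousAt (fun z : Point => z 2) x := (continuous_apply 2).continuousAt
  have cy : ContinuousAt (fun z : Point => y (z 1)) x :=
    ContinuousAt.comp (f := fun z : Point => z 1) (hy _ h1) c1
  filter_upwards [c1.eventually_const_lt h1, cy.eventually_const_lt h2,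
    c2.eventually_const_lt h3, c2.eventually_lt_const h4] with z a b c d
  exact ⟨a, b, c, d⟩

/-! ### Christoffel symbols of the static metric -/

/-- The static metric with `h = 1`. -/
abbrev lapseMetric (y : ℝ → ℝ) : Tensor2 := staticMetric y fun _ => 1

theorem sin_pos_of_mem {y : ℝ → ℝ} {x : Point} (hx : x ∈ staticChart y) :
    0 < Real.sin (x 2) :=
  Real.sin_pos_of_pos_of_lt_pi hx.2.2.1 hx.2.2.2

theorem invMetric_lapseMetric {y : ℝ → ℝ} {x : Point} (hx : x ∈ staticChart y) :
    invMetric (lapseMetric y) x =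
      Matrix.diagonal ![-1 / y (x 1), y (x 1), 1 / x 1 ^ 2,
        1 / (x 1 ^ 2 * Real.sin (x 2) ^ 2)] := by
  have hs := (sin_pos_of_mem hx).ne'
  obtain ⟨h1, h2, -, -⟩ := hx
  apply Matrix.inv_eq_left_inv
  rw [lapseMetric, staticMetric, Matrix.diagonal_mul_diagonal, ← Matrix.diagonal_one]
  congr 1
  funext i
  fin_cases i <;> simp <;> field_simp

theorem partialD_lapseMetric {y y1 : ℝ → ℝ} (hy1 : ∀ r, 0 < r → HasDerivAt y (y1 r) r)
    {x : Point} (hx : x ∈ staticChart y) (i a b : Fin 4) :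
    partialD i (fun z => lapseMetric y z a b) x =
      ![0, Matrix.diagonal ![-y1 (x 1), -y1 (x 1) / y (x 1) ^ 2, 2 * x 1,
          2 * x 1 * Real.sin (x 2) ^ 2] a b,
        Matrix.diagonal ![0, 0, 0, x 1 ^ 2 * (2 * Real.sin (x 2) * Real.cos (x 2))] a b, 0] i := by
  obtain ⟨h1, h2, -, -⟩ := hx
  have hy := hy1 _ h1
  have hsq : HasDerivAt (fun r : ℝ => r ^ 2) (2 * x 1) (x 1) := by
    simpa using hasDerivAt_pow 2 (x 1)
  have hsin : HasDerivAt (fun s : ℝ => Real.sin s ^ 2)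
      (2 * Real.sin (x 2) * Real.cos (x 2)) (x 2) := by
    simpa using (Real.hasDerivAt_sin (x 2)).fun_pow 2
  by_cases hab : a = b
  · subst hab
    fin_cases a
    · simpa [staticMetric] using partialD_radial hy.neg i
    · simpa [staticMetric] using partialD_radial (hy.inv h2.ne') i
    · simpa [staticMetric] using partialD_radial hsq i
    · simpa [staticMetric] using partialD_mul_radial_polar hsq hsin i
  · simp only [staticMetric, Matrix.diagonal_apply_ne _ hab]
    fin_cases i <;> simp [partialD]

/-- The radial factors of the Christoffel symbols. -/
def gammaRadial (y y1 : ℝ → ℝ) (r : ℝ) : Fin 4 → Matrix (Fin 4) (Fin 4) ℝ :=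
  ![!![0, y1 r / (2 * y r), 0, 0; y1 r / (2 * y r), 0, 0, 0; 0, 0, 0, 0; 0, 0, 0, 0],
    !![y r * y1 r / 2, 0, 0, 0; 0, -(y1 r / (2 * y r)), 0, 0; 0, 0, -(r * y r), 0;
      0, 0, 0, -(r * y r)],
    !![0, 0, 0, 0; 0, 0, 1 / r, 0; 0, 1 / r, 0, 0; 0, 0, 0, 1],
    !![0, 0, 0, 0; 0, 0, 0, 1 / r; 0, 0, 0, 1; 0, 1 / r, 1, 0]]

/-- The derivatives of the radial factors of the Christoffel symbols. -/
def gammaRadialDeriv (y y1 y2 : ℝ → ℝ) (r : ℝ) : Fin 4 → Matrix (Fin 4) (Fin 4) ℝ :=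
  let q := (y2 r * y r - y1 r ^ 2) / (2 * y r ^ 2)
  ![!![0, q, 0, 0; q, 0, 0, 0; 0, 0, 0, 0; 0, 0, 0, 0],
    !![(y1 r ^ 2 + y r * y2 r) / 2, 0, 0, 0; 0, -q, 0, 0; 0, 0, -(y r + r * y1 r), 0;
      0, 0, 0, -(y r + r * y1 r)],
    !![0, 0, 0, 0; 0, 0, -(1 / r ^ 2), 0; 0, -(1 / r ^ 2), 0, 0; 0, 0, 0, 0],
    !![0, 0, 0, 0; 0, 0, 0, -(1 / r ^ 2); 0, 0, 0, 0; 0, -(1 / r ^ 2), 0, 0]]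

/-- The polar factors of the Christoffel symbols. -/
def gammaPolar (s : ℝ) : Fin 4 → Matrix (Fin 4) (Fin 4) ℝ :=
  ![!![1, 1, 1, 1; 1, 1, 1, 1; 1, 1, 1, 1; 1, 1, 1, 1],
    !![1, 1, 1, 1; 1, 1, 1, 1; 1, 1, 1, 1; 1, 1, 1, Real.sin s ^ 2],
    !![1, 1, 1, 1; 1, 1, 1, 1; 1, 1, 1, 1; 1, 1, 1, -(Real.sin s * Real.cos s)],
    !![1, 1, 1, 1; 1, 1, 1, 1; 1, 1, 1, Real.cos s / Real.sin s;
      1, 1, Real.cos s / Real.sin s, 1]]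

/-- The derivatives of the polar factors of the Christoffel symbols. -/
def gammaPolarDeriv (s : ℝ) : Fin 4 → Matrix (Fin 4) (Fin 4) ℝ :=
  ![0,
    !![0, 0, 0, 0; 0, 0, 0, 0; 0, 0, 0, 0; 0, 0, 0, 2 * Real.sin s * Real.cos s],
    !![0, 0, 0, 0; 0, 0, 0, 0; 0, 0, 0, 0; 0, 0, 0, Real.sin s ^ 2 - Real.cos s ^ 2],
    !![0, 0, 0, 0; 0, 0, 0, 0; 0, 0, 0, -(1 / Real.sin s ^ 2); 0, 0, -(1 / Real.sin s ^ 2), 0]]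

/-- Factoring each symbol into a radial and a polar part reduces its partial derivatives to
one-variable calculus via `partialD_mul_radial_polar`. Where the radial factor is zero, the polar
factor 1 is only a filler. -/
theorem christoffel_lapseMetric {y y1 : ℝ → ℝ} (hy1 : ∀ r, 0 < r → HasDerivAt y (y1 r) r)
    {x : Point} (hx : x ∈ staticChart y) (a b c : Fin 4) :
    christoffel (lapseMetric y) a b c x =
      gammaRadial y y1 (x 1) a b c * gammaPolar (x 2) a b c := by
  have hs := (sin_pos_of_mem hx).ne'
  have h1 := hx.1.ne'
  have h2 := hx.2.1.ne'
  simp only [christoffel, invMetric_lapseMetric hx, partialD_lapseMetric hy1 hx]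
  rw [Finset.sum_eq_single a (fun e _ he => by simp [Matrix.diagonal_apply_ne' _ he]) (by simp)]
  fin_cases a <;> fin_cases b <;> fin_cases c <;>
    simp [gammaRadial, gammaPolar] <;> try field_simp

theorem hasDerivAt_gammaRadial {y y1 y2 : ℝ → ℝ} (hy1 : ∀ r, 0 < r → HasDerivAt y (y1 r) r)
    (hy2 : ∀ r, 0 < r → HasDerivAt y1 (y2 r) r) {r : ℝ} (hr : 0 < r) (hyr : y r ≠ 0)
    (a b c : Fin 4) :
    HasDerivAt (fun s => gammaRadial y y1 s a b c) (gammaRadialDeriv y y1 y2 r a b c) r := by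
  have k0 := hasDerivAt_const r (0 : ℝ)
  have k1 := hasDerivAt_const r (1 : ℝ)
  have q : HasDerivAt (fun s => y1 s / (2 * y s))
      ((y2 r * y r - y1 r ^ 2) / (2 * y r ^ 2)) r := by
    refine HasDerivAt.congr_deriv ((hy2 r hr).fun_div ((hy1 r hr).const_mul 2) (by simpa using hyr)) ?_
    field_simp
  have p : HasDerivAt (fun s => y s * y1 s / 2) ((y1 r ^ 2 + y r * y2 r) / 2) r := by
    refine HasDerivAt.congr_deriv (((hy1 r hr).fun_mul (hy2 r hr)).div_const 2) ?_
    ring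
  have m : HasDerivAt (fun s => -(s * y s)) (-(y r + r * y1 r)) r := by
    refine HasDerivAt.congr_deriv (((hasDerivAt_id r).fun_mul (hy1 r hr)).fun_neg) ?_
    simp
  have i : HasDerivAt (fun s : ℝ => 1 / s) (-(1 / r ^ 2)) r := by
    simpa using hasDerivAt_inv hr.ne'
  fin_cases a <;> fin_cases b <;> fin_cases c <;>
    simp only [gammaRadial, gammaRadialDeriv, Fin.mk_one, Fin.zero_eta, Fin.reduceFinMk,
      Matrix.cons_val, Matrix.of_apply] <;>
    with_reducible first | exact k0 | exact k1 | exact q | exact p | exact m | exact i | exact q.fun_neg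

theorem hasDerivAt_gammaPolar {s : ℝ} (hs : Real.sin s ≠ 0) (a b c : Fin 4) :
    HasDerivAt (fun s => gammaPolar s a b c) (gammaPolarDeriv s a b c) s := by
  have k1 := hasDerivAt_const s (1 : ℝ)
  have hsin : HasDerivAt (fun s : ℝ => Real.sin s ^ 2) (2 * Real.sin s * Real.cos s) s := by
    simpa using (Real.hasDerivAt_sin s).fun_pow 2
  have p : HasDerivAt (fun s : ℝ => -(Real.sin s * Real.cos s))
      (Real.sin s ^ 2 - Real.cos s ^ 2) s := by
    refine HasDerivAt.congr_deriv (((Real.hasDerivAt_sin s).fun_mul (Real.hasDerivAt_cos s)).fun_neg) ?_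
    ring
  have q : HasDerivAt (fun s : ℝ => Real.cos s / Real.sin s) (-(1 / Real.sin s ^ 2)) s := by
    refine HasDerivAt.congr_deriv ((Real.hasDerivAt_cos s).fun_div (Real.hasDerivAt_sin s) hs) ?_
    -- The numerator 1 becomes sin² + cos², after which the identity is purely algebraic.
    rw [← Real.sin_sq_add_cos_sq s]
    ring
  fin_cases a <;> fin_cases b <;> fin_cases c <;>
    simp only [gammaPolar, gammaPolarDeriv, Fin.mk_one, Fin.zero_eta, Fin.reduceFinMk,
      Matrix.cons_val, Matrix.of_apply, Matrix.zero_apply] <;>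
    with_reducible first | exact k1 | exact hsin | exact p | exact q

theorem partialD_christoffel {y y1 y2 : ℝ → ℝ} (hy1 : ∀ r, 0 < r → HasDerivAt y (y1 r) r)
    (hy2 : ∀ r, 0 < r → HasDerivAt y1 (y2 r) r) {x : Point} (hx : x ∈ staticChart y)
    (i a b c : Fin 4) :
    partialD i (christoffel (lapseMetric y) a b c) x =
      ![0, gammaRadialDeriv y y1 y2 (x 1) a b c * gammaPolar (x 2) a b c,
        gammaRadial y y1 (x 1) a b c * gammaPolarDeriv (x 2) a b c, 0] i := by
  have ho := isOpen_staticChart (y := y) fun r hr => (hy1 r hr).continuousAt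
  rw [partialD_congr i ((ho.eventually_mem hx).mono fun z hz =>
    christoffel_lapseMetric hy1 hz a b c)]
  exact partialD_mul_radial_polar
    (hasDerivAt_gammaRadial hy1 hy2 hx.1 hx.2.1.ne' a b c)
    (hasDerivAt_gammaPolar (sin_pos_of_mem hx).ne' a b c) i

/-! ### Curvature of the static metric -/

/-- The sectional curvatures of the coordinate planes of the static metric with `h = 1`. -/
def sectional (y y1 y2 : ℝ → ℝ) (r : ℝ) : Matrix (Fin 4) (Fin 4) ℝ :=
  let p := -(y2 r) / 2
  let q := -(y1 r) / (2 * r)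
  let s := (1 - y r) / r ^ 2
  !![0, p, q, q; p, 0, q, q; q, q, 0, s; q, q, s, 0]

-- This is the form of a curvature operator diagonal on coordinate planes. It makes every later
-- contraction a short finite sum.
set_option maxHeartbeats 4000000 in
theorem riemannUp_lapseMetric {y y1 y2 : ℝ → ℝ} (hy1 : ∀ r, 0 < r → HasDerivAt y (y1 r) r)
    (hy2 : ∀ r, 0 < r → HasDerivAt y1 (y2 r) r) {x : Point} (hx : x ∈ staticChart y)
    (a b c d : Fin 4) :
    riemannUp (lapseMetric y) a b c d x =
      sectional y y1 y2 (x 1) a b *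
        ((if a = c then lapseMetric y x b d else 0) -
          (if a = d then lapseMetric y x b c else 0)) := by
  have hs := (sin_pos_of_mem hx).ne'
  have h1 := hx.1.ne'
  have h2 := hx.2.1.ne'
  have hc : Real.cos (x 2) ^ 2 = 1 - Real.sin (x 2) ^ 2 := Real.cos_sq' _
  simp only [riemannUp, partialD_christoffel hy1 hy2 hx, christoffel_lapseMetric hy1 hx,
    Fin.sum_univ_four]
  simp only [lapseMetric, staticMetric]
  fin_cases a <;> fin_cases b <;> fin_cases c <;> fin_cases d <;>
    simp [gammaRadial, gammaPolar, gammaRadialDeriv, gammaPolarDeriv, sectional] <;>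
    field_simp <;> (try simp only [hc]) <;> ring

/-- The eigenvalue of the Ricci tensor of the static metric on the `t`-`r` plane. -/
def ricciBase (y1 y2 : ℝ → ℝ) (r : ℝ) : ℝ := -(y2 r) / 2 - y1 r / r

/-- The eigenvalue of the Ricci tensor of the static metric on the spheres. -/
def ricciSphere (y y1 : ℝ → ℝ) (r : ℝ) : ℝ := -(y1 r) / r + (1 - y r) / r ^ 2

theorem ricci_lapseMetric {y y1 y2 : ℝ → ℝ} (hy1 : ∀ r, 0 < r → HasDerivAt y (y1 r) r)
    (hy2 : ∀ r, 0 < r → HasDerivAt y1 (y2 r) r) {x : Point} (hx : x ∈ staticChart y) :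
    ricci (lapseMetric y) x =
      Matrix.diagonal ![-y (x 1) * ricciBase y1 y2 (x 1), ricciBase y1 y2 (x 1) / y (x 1),
        x 1 ^ 2 * ricciSphere y y1 (x 1),
        x 1 ^ 2 * Real.sin (x 2) ^ 2 * ricciSphere y y1 (x 1)] := by
  have hs := (sin_pos_of_mem hx).ne'
  have h1 := hx.1.ne'
  have h2 := hx.2.1.ne'
  ext b d
  simp only [ricci, Matrix.of_apply, riemannUp_lapseMetric hy1 hy2 hx, Fin.sum_univ_four]
  simp only [lapseMetric, staticMetric]
  fin_cases b <;> fin_cases d <;> simp [sectional, ricciBase, ricciSphere] <;> field_simp <;> ring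

theorem scalarCurv_lapseMetric {y y1 y2 : ℝ → ℝ} (hy1 : ∀ r, 0 < r → HasDerivAt y (y1 r) r)
    (hy2 : ∀ r, 0 < r → HasDerivAt y1 (y2 r) r) {x : Point} (hx : x ∈ staticChart y) :
    scalarCurv (lapseMetric y) x = 2 * ricciBase y1 y2 (x 1) + 2 * ricciSphere y y1 (x 1) := by
  have hs := (sin_pos_of_mem hx).ne'
  have h1 := hx.1.ne'
  have h2 := hx.2.1.ne'
  simp only [scalarCurv, invMetric_lapseMetric hx, ricci_lapseMetric hy1 hy2 hx,
    Fin.sum_univ_four]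
  simp
  field_simp
  ring

theorem einstein_lapseMetric {y y1 y2 : ℝ → ℝ} (hy1 : ∀ r, 0 < r → HasDerivAt y (y1 r) r)
    (hy2 : ∀ r, 0 < r → HasDerivAt y1 (y2 r) r) {x : Point} (hx : x ∈ staticChart y) :
    einstein (lapseMetric y) x =
      Matrix.diagonal ![y (x 1) * ricciSphere y y1 (x 1), -(ricciSphere y y1 (x 1) / y (x 1)),
        -(x 1 ^ 2 * ricciBase y1 y2 (x 1)),
        -(x 1 ^ 2 * Real.sin (x 2) ^ 2 * ricciBase y1 y2 (x 1))] := by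
  rw [einstein, scalarCurv_lapseMetric hy1 hy2 hx, ricci_lapseMetric hy1 hy2 hx,
    lapseMetric, staticMetric, ← Matrix.diagonal_smul, Matrix.diagonal_sub]
  congr 1
  funext i
  fin_cases i <;> simp <;> ring

theorem einsteinUp_lapseMetric {y y1 y2 : ℝ → ℝ} (hy1 : ∀ r, 0 < r → HasDerivAt y (y1 r) r)
    (hy2 : ∀ r, 0 < r → HasDerivAt y1 (y2 r) r) {x : Point} (hx : x ∈ staticChart y) :
    einsteinUp (lapseMetric y) x =
      Matrix.diagonal ![ricciSphere y y1 (x 1) / y (x 1), -(ricciSphere y y1 (x 1) * y (x 1)),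
        -(ricciBase y1 y2 (x 1) / x 1 ^ 2),
        -(ricciBase y1 y2 (x 1) / (x 1 ^ 2 * Real.sin (x 2) ^ 2))] := by
  have hs := (sin_pos_of_mem hx).ne'
  have h1 := hx.1.ne'
  have h2 := hx.2.1.ne'
  ext k l
  simp only [einsteinUp, Matrix.of_apply, invMetric_lapseMetric hx,
    einstein_lapseMetric hy1 hy2 hx, Fin.sum_univ_four]
  fin_cases k <;> fin_cases l <;> simp <;> field_simp

/-! ### The wave operator and the current -/

/-- The wave operator on a radial function. -/
theorem laplacian_lapseMetric {y y1 F F1 F2 : ℝ → ℝ}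
    (hy1 : ∀ r, 0 < r → HasDerivAt y (y1 r) r)
    (hF1 : ∀ r, 0 < r → HasDerivAt F (F1 r) r) (hF2 : ∀ r, 0 < r → HasDerivAt F1 (F2 r) r)
    {f : Point → ℝ} (hf : ∀ z ∈ staticChart y, f z = F (z 1))
    {x : Point} (hx : x ∈ staticChart y) :
    laplacian (lapseMetric y) f x =
      y (x 1) * F2 (x 1) + (y1 (x 1) + 2 * y (x 1) / x 1) * F1 (x 1) := by
  have ho := isOpen_staticChart (y := y) fun r hr => (hy1 r hr).continuousAt
  have d1 : ∀ z ∈ staticChart y, ∀ i, partialD i f z = ![0, F1 (z 1), 0, 0] i := by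
    intro z hz i
    rw [partialD_congr i ((ho.eventually_mem hz).mono hf)]
    exact partialD_radial (hF1 _ hz.1) i
  have d2 : ∀ i j, partialD i (partialD j f) x =
      if j = 1 then ![0, F2 (x 1), 0, 0] i else 0 := by
    intro i j
    rw [partialD_congr i ((ho.eventually_mem hx).mono fun z hz => d1 z hz j)]
    split_ifs with hj
    · subst hj
      exact partialD_radial (hF2 _ hx.1) i
    · have : (fun z : Point => ![0, F1 (z 1), 0, 0] j) = fun _ => 0 := by
        funext z
        fin_cases j <;> simp at hj ⊢
      rw [this]
      simp [partialD]
  have hs := (sin_pos_of_mem hx).ne'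
  have h1 := hx.1.ne'
  have h2 := hx.2.1.ne'
  simp only [laplacian, d2, d1 x hx, invMetric_lapseMetric hx, christoffel_lapseMetric hy1 hx,
    Fin.sum_univ_four]
  simp [gammaRadial, gammaPolar]
  field_simp
  ring

/-- The proportionality factor of the current of the static metric, in terms of the value `L` of
the wave operator on the scalar curvature. -/
def lapseCurrentScalar (y y1 y2 : ℝ → ℝ) (L r : ℝ) : ℝ :=
  let a := ricciBase y1 y2 r
  let b := ricciSphere y y1 r
  a ^ 2 + b ^ 2 - 2 / 3 * (a + b) ^ 2 + L / 2
    + 4 * (-(y2 r) / 2 * b - y1 r / r * a) + 2 * b ^ 2 - 8 / 3 * (a + b) * b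

/-- Diagonality kills the spatial components. The wave term stays unevaluated because R already
contains y'', and only two derivatives of y are assumed; everything else is algebraic in the
curvature. -/
theorem current_lapseMetric {y y1 y2 : ℝ → ℝ} (hy1 : ∀ r, 0 < r → HasDerivAt y (y1 r) r)
    (hy2 : ∀ r, 0 < r → HasDerivAt y1 (y2 r) r) {x : Point} (hx : x ∈ staticChart y) :
    current (lapseMetric y) x =
      ![-y (x 1) * lapseCurrentScalar y y1 y2
        (laplacian (lapseMetric y) (scalarCurv (lapseMetric y)) x) (x 1), 0, 0, 0] := by
  have hs := (sin_pos_of_mem hx).ne'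
  have h1 := hx.1.ne'
  have h2 := hx.2.1.ne'
  funext k
  simp only [current, killing, Matrix.mulVec_single_one, Matrix.col_apply, altasTekin,
    Matrix.of_apply]
  generalize laplacian (lapseMetric y) (scalarCurv (lapseMetric y)) x = L
  simp only [riemann, riemannUp_lapseMetric hy1 hy2 hx, invMetric_lapseMetric hx,
    einstein_lapseMetric hy1 hy2 hx, einsteinUp_lapseMetric hy1 hy2 hx,
    scalarCurv_lapseMetric hy1 hy2 hx, Fin.sum_univ_four, lapseCurrentScalar]
  generalize ricciBase y1 y2 (x 1) = a
  generalize ricciSphere y y1 (x 1) = b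
  simp only [lapseMetric, staticMetric]
  fin_cases k <;> simp [sectional]
  field_simp
  ring

theorem killingLow_lapseMetric (y : ℝ → ℝ) (x : Point) :
    killingLow (lapseMetric y) x = ![-y (x 1), 0, 0, 0] := by
  funext k
  simp only [killingLow, killing, Matrix.mulVec_single_one, Matrix.col_apply, staticMetric]
  fin_cases k <;> simp

/-! ### Specialization to Harada's metric -/

/-- The first derivative of `haradaY`. -/
def haradaY1 (M Λ lam r : ℝ) : ℝ := 2 * M / r ^ 2 - 2 * Λ / 3 * r - 4 * lam / 5 * r ^ 3

/-- The second derivative of `haradaY`. -/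
def haradaY2 (M Λ lam r : ℝ) : ℝ := -(4 * M / r ^ 3) - 2 * Λ / 3 - 12 * lam / 5 * r ^ 2

theorem hasDerivAt_const_mul_pow (c r : ℝ) (n : ℕ) :
    HasDerivAt (fun s : ℝ => c * s ^ n) (c * (n * r ^ (n - 1))) r :=
  (hasDerivAt_pow n r).const_mul c

theorem hasDerivAt_haradaY (M Λ lam : ℝ) (r : ℝ) (hr : 0 < r) :
    HasDerivAt (haradaY M Λ lam) (haradaY1 M Λ lam r) r := by
  have hi : HasDerivAt (fun s : ℝ => 2 * M / s) (2 * M * -(r ^ 2)⁻¹) r := by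
    simpa only [div_eq_mul_inv] using (hasDerivAt_inv hr.ne').const_mul (2 * M)
  refine HasDerivAt.congr_deriv ((((hasDerivAt_const r (1 : ℝ)).fun_sub hi).fun_sub
    (hasDerivAt_const_mul_pow (Λ / 3) r 2)).fun_sub
    (hasDerivAt_const_mul_pow (lam / 5) r 4)) ?_
  unfold haradaY1
  push_cast
  ring

theorem hasDerivAt_haradaY1 (M Λ lam : ℝ) (r : ℝ) (hr : 0 < r) :
    HasDerivAt (haradaY1 M Λ lam) (haradaY2 M Λ lam r) r := by
  have hi : HasDerivAt (fun s : ℝ => 2 * M / s ^ 2)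
      (2 * M * (-((2 : ℕ) * r ^ (2 - 1)) / (r ^ 2) ^ 2)) r := by
    simpa only [div_eq_mul_inv] using
      ((hasDerivAt_pow 2 r).fun_inv (pow_ne_zero 2 hr.ne')).const_mul (2 * M)
  have hl : HasDerivAt (fun s : ℝ => 2 * Λ / 3 * s) (2 * Λ / 3 * 1) r :=
    (hasDerivAt_id r).const_mul _
  refine HasDerivAt.congr_deriv ((hi.fun_sub hl).fun_sub
    (hasDerivAt_const_mul_pow (4 * lam / 5) r 3)) ?_
  unfold haradaY2
  push_cast
  field_simp
  ring

/-- The term 2M/r in y contributes nothing to either Ricci eigenvalue, as for Schwarzschild. -/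
theorem ricciBase_harada (M Λ lam : ℝ) {r : ℝ} (hr : 0 < r) :
    ricciBase (haradaY1 M Λ lam) (haradaY2 M Λ lam) r = Λ + 2 * lam * r ^ 2 := by
  unfold ricciBase haradaY1 haradaY2
  field_simp
  ring

theorem ricciSphere_harada (M Λ lam : ℝ) {r : ℝ} (hr : 0 < r) :
    ricciSphere (haradaY M Λ lam) (haradaY1 M Λ lam) r = Λ + lam * r ^ 2 := by
  unfold ricciSphere haradaY haradaY1
  field_simp
  ring

theorem scalarCurv_haradaMetric (M Λ lam : ℝ) {x : Point}
    (hx : x ∈ staticChart (haradaY M Λ lam)) :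
    scalarCurv (haradaMetric M Λ lam) x = 4 * Λ + 6 * lam * x 1 ^ 2 := by
  rw [haradaMetric, scalarCurv_lapseMetric (hasDerivAt_haradaY M Λ lam)
    (hasDerivAt_haradaY1 M Λ lam) hx, ricciBase_harada _ _ _ hx.1, ricciSphere_harada _ _ _ hx.1]
  ring

theorem laplacian_scalarCurv_haradaMetric (M Λ lam : ℝ) {x : Point}
    (hx : x ∈ staticChart (haradaY M Λ lam)) :
    laplacian (haradaMetric M Λ lam) (scalarCurv (haradaMetric M Λ lam)) x =
      36 * lam - 48 * M * lam / x 1 - 20 * Λ * lam * x 1 ^ 2 - 84 / 5 * lam ^ 2 * x 1 ^ 4 := by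
  have hr := hx.1.ne'
  have hF1 : ∀ r : ℝ, 0 < r →
      HasDerivAt (fun s => 4 * Λ + 6 * lam * s ^ 2) (12 * lam * r) r := fun r _ =>
    ((hasDerivAt_const_mul_pow (6 * lam) r 2).const_add (4 * Λ)).congr_deriv (by push_cast; ring)
  have hF2 : ∀ r : ℝ, 0 < r → HasDerivAt (fun s => 12 * lam * s) (12 * lam) r := fun r _ =>
    ((hasDerivAt_id r).const_mul (12 * lam)).congr_deriv (mul_one _)
  refine (laplacian_lapseMetric (hasDerivAt_haradaY M Λ lam) hF1 hF2
    (fun z hz => scalarCurv_haradaMetric M Λ lam hz) hx).trans ?_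
  unfold haradaY haradaY1
  field_simp
  ring

/-- The current scalar of the Harada metric. -/
def haradaScalar (M Λ lam r : ℝ) : ℝ :=
  -(32 * M * lam / r) + 18 * lam - 20 / 3 * Λ * lam * r ^ 2 - 21 / 5 * lam ^ 2 * r ^ 4

theorem current_haradaMetric (M Λ lam : ℝ) {x : Point}
    (hx : x ∈ staticChart (haradaY M Λ lam)) :
    current (haradaMetric M Λ lam) x =
      ![-haradaY M Λ lam (x 1) * haradaScalar M Λ lam (x 1), 0, 0, 0] := by
  have h : lapseCurrentScalar (haradaY M Λ lam) (haradaY1 M Λ lam) (haradaY2 M Λ lam)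
      (laplacian (haradaMetric M Λ lam) (scalarCurv (haradaMetric M Λ lam)) x) (x 1) =
      haradaScalar M Λ lam (x 1) := by
    have hr := hx.1.ne'
    rw [laplacian_scalarCurv_haradaMetric M Λ lam hx, lapseCurrentScalar,
      ricciBase_harada _ _ _ hx.1, ricciSphere_harada _ _ _ hx.1]
    unfold haradaY1 haradaY2 haradaScalar
    field_simp
    ring
  rw [← h]
  exact current_lapseMetric (hasDerivAt_haradaY M Λ lam) (hasDerivAt_haradaY1 M Λ lam) hx

/-- Only the time component is a nontrivial condition, and there y > 0 can be cancelled. -/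
theorem isCurrentScalar_haradaMetric_iff (M Λ lam : ℝ) {x : Point}
    (hx : x ∈ staticChart (haradaY M Λ lam)) (c : ℝ) :
    IsCurrentScalar (haradaMetric M Λ lam) x c ↔ c = haradaScalar M Λ lam (x 1) := by
  have hy := hx.2.1.ne'
  rw [IsCurrentScalar, current_haradaMetric M Λ lam hx, haradaMetric, killingLow_lapseMetric]
  constructor
  · intro h
    have h0 : -haradaY M Λ lam (x 1) * haradaScalar M Λ lam (x 1) =
        c * -haradaY M Λ lam (x 1) := h 0
    rw [mul_comm c] at h0
    exact (mul_left_cancel₀ (neg_ne_zero.mpr hy) h0).symm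
  · rintro rfl k
    fin_cases k <;> simp [mul_comm]

/-! ### Vanishing of the current on open sets -/

theorem current_haradaMetric_eq_zero_iff (M Λ lam : ℝ) {x : Point}
    (hx : x ∈ staticChart (haradaY M Λ lam)) :
    current (haradaMetric M Λ lam) x = 0 ↔ haradaScalar M Λ lam (x 1) = 0 := by
  rw [current_haradaMetric M Λ lam hx]
  constructor
  · intro h
    have h0 : -haradaY M Λ lam (x 1) * haradaScalar M Λ lam (x 1) = 0 := congrFun h 0
    exact (mul_eq_zero.mp h0).resolve_left (neg_ne_zero.mpr hx.2.1.ne')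
  · intro h
    simp [h]

open Polynomial in
/-- The current scalar has infinitely many zeros only if `lam = 0`. -/
theorem eq_zero_of_infinite_haradaScalar_eq_zero {M Λ lam : ℝ}
    (h : {r : ℝ | r ≠ 0 ∧ haradaScalar M Λ lam r = 0}.Infinite) : lam = 0 := by
  -- This is 15rφ(r): the factor r clears 1/r, and 15 clears the denominators 3 and 5.
  let p : ℝ[X] := C (-(480 * M * lam)) + C (270 * lam) * X ^ 1 + C (-(100 * Λ * lam)) * X ^ 3
    + C (-(63 * lam ^ 2)) * X ^ 5
  have hp : p = 0 := by
    refine p.eq_zero_of_infinite_isRoot (h.mono ?_)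
    rintro r ⟨hr, hz⟩
    have : p.eval r = 15 * r * haradaScalar M Λ lam r := by
      simp only [p, haradaScalar, eval_add, eval_mul, eval_C, eval_pow, eval_X]
      field_simp
      ring
    change p.eval r = 0
    rw [this, hz, mul_zero]
  -- The linear coefficient comes from 18λ alone, so M and Λ cannot cancel it.
  have hc : p.coeff 1 = 270 * lam := by
    simp only [p, coeff_add, coeff_C_mul_X_pow, coeff_C]
    norm_num
  rw [hp, coeff_zero] at hc
  linarith

theorem current_haradaMetric_eq_zero_on_iff (M Λ lam : ℝ) {U : Set Point} (hU : IsOpen U)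
    (hne : U.Nonempty) (hsub : U ⊆ staticChart (haradaY M Λ lam)) :
    (∀ x ∈ U, current (haradaMetric M Λ lam) x = 0) ↔ lam = 0 := by
  constructor
  · intro h
    obtain ⟨x, hx⟩ := hne
    -- Varying r alone through a point of U stays in U for a neighbourhood of radii, hence for
    -- infinitely many.
    have hc : Continuous fun s : ℝ => Function.update x 1 s :=
      continuous_const.update 1 continuous_id
    have hn : (fun s : ℝ => Function.update x 1 s) ⁻¹' U ∈ 𝓝 (x 1) :=
      (hU.preimage hc).mem_nhds (by simpa using hx)
    refine eq_zero_of_infinite_haradaScalar_eq_zero (M := M) (Λ := Λ)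
      ((infinite_of_mem_nhds _ hn).mono fun s hs => ?_)
    have h1 := hsub hs
    have h2 := (current_haradaMetric_eq_zero_iff M Λ lam h1).mp (h _ hs)
    have h3 := h1.1.ne'
    simp only [Function.update_self] at h2 h3
    exact ⟨h3, h2⟩
  · rintro rfl x hx
    rw [current_haradaMetric_eq_zero_iff M Λ 0 (hsub hx)]
    simp [haradaScalar]

/-! ### The Schwarzschild–de Sitter case and the conclusion -/

theorem einstein_haradaMetric_zero (M Λ : ℝ) {x : Point}
    (hx : x ∈ staticChart (haradaY M Λ 0)) :
    einstein (haradaMetric M Λ 0) x = (-Λ) • haradaMetric M Λ 0 x := by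
  rw [haradaMetric, einstein_lapseMetric (hasDerivAt_haradaY M Λ 0) (hasDerivAt_haradaY1 M Λ 0) hx,
    ricciBase_harada _ _ _ hx.1, ricciSphere_harada _ _ _ hx.1, staticMetric,
    ← Matrix.diagonal_smul]
  congr 1
  funext i
  fin_cases i <;> simp <;> ring

end HaradaVacuum

end

theorem mainTheorem3 (M Λ lam : ℝ) :
    (∀ x ∈ HaradaVacuum.staticChart (HaradaVacuum.haradaY M Λ lam), ∀ c : ℝ,
      HaradaVacuum.IsCurrentScalar (HaradaVacuum.haradaMetric M Λ lam) x c ↔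
        c = -(32 * M * lam / x 1) + 18 * lam - 20 / 3 * Λ * lam * x 1 ^ 2
              - 21 / 5 * lam ^ 2 * x 1 ^ 4) ∧
    (∀ U : Set HaradaVacuum.Point, IsOpen U → U.Nonempty →
      U ⊆ HaradaVacuum.staticChart (HaradaVacuum.haradaY M Λ lam) →
        ((∀ x ∈ U, HaradaVacuum.current (HaradaVacuum.haradaMetric M Λ lam) x = 0) ↔
          lam = 0)) ∧
    (lam = 0 →
      ∀ x ∈ HaradaVacuum.staticChart (HaradaVacuum.haradaY M Λ lam),
        HaradaVacuum.einstein (HaradaVacuum.haradaMetric M Λ lam) x =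
          (-Λ) • HaradaVacuum.haradaMetric M Λ lam x) := by
  exact
    ⟨fun x hx c => HaradaVacuum.isCurrentScalar_haradaMetric_iff M Λ lam hx c,
      fun U hU hne hsub => HaradaVacuum.current_haradaMetric_eq_zero_on_iff M Λ lam hU hne hsub,
      by
        rintro rfl x hx
        exact HaradaVacuum.einstein_haradaMetric_zero M Λ hx⟩
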